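/- Let $p\in(0,1)$, let $r\ge 1$ and $n$ be natural numbers, and let $\mathcal E_n$ be the elliptope, i.e. the convex set of real positive semidefinite $n\times n$ matrices whose diagonal entries all equal $1$. Let $\xi_1,\dots,\xi_r$ be independent random vectors in $\{\pm1\}^n$, each with $n$ independent entries that equal $+1$ with probability $p$ and $-1$ with probability $1-p$, and let $$F:=\operatorname{conv}\{\xi_1\xi_1^{\mathsf t},\dots,\xi_r\xi_r^{\mathsf t}\}.$$ A face of a convex set $K$ is a convex subset $G\subseteq K$ such that $x,y\in K$ and $\theta x+(1-\theta)y\in G$ for some $\theta\in(0,1)$ imply $x,y\in G$; a face of dimension $k$ (the dimension of its affine hull) is simplicial if it is the convex hull of an affinely independent family of $k+1$ points. Then $$\mathbb P\{F\text{ is a simplicial face of }\mathcal E_n\text{ with dimension }r-1\}\;\ge\;1-r^2\exp\!\left(\frac{-4p^2(1-p)^2n}{r^2}\right).$$ -/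

import Mathlib

open MeasureTheory ProbabilityTheory

noncomputable section

/-- The elliptope: the real positive semidefinite `n × n` matrices with unit diagonal. -/
def elliptope (n : ℕ) : Set (Matrix (Fin n) (Fin n) ℝ) :=
  {X | X.PosSemidef ∧ ∀ i, X i i = 1}

/-- A face of a convex set `K`: a convex, extreme subset of `K`. -/
structure IsConvexFace {E : Type*} [AddCommGroup E] [Module ℝ E] (K F : Set E) : Prop where
  convex : Convex ℝ F
  isExtreme : IsExtreme ℝ K F

/-- The dimension of a (nonempty) convex set: the dimension of its affine hull. -/
def convexDim {E : Type*} [AddCommGroup E] [Module ℝ E] (K : Set E) : ℕ :=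
  Module.finrank ℝ (affineSpan ℝ K).direction

/-- `F` is a `k`-dimensional simplicial face of `K`: a `k`-dimensional face of `K` that is the
convex hull of an affinely independent family of `k + 1` points. -/
structure IsSimplicialFace {E : Type*} [AddCommGroup E] [Module ℝ E] (K F : Set E) (k : ℕ) :
    Prop where
  isFace : IsConvexFace K F
  dim_eq : convexDim F = k
  exists_simplex : ∃ v : Fin (k + 1) → E,
    AffineIndependent ℝ v ∧ F = convexHull ℝ (Set.range v)

/-- The signed Bernoulli distribution: `+1` with probability `p` and `-1` with
probability `1 - p`. -/
def sbern (p : unitInterval) : Measure ℝ :=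
  bernoulliMeasure (1 : ℝ) (-1) p

/-- The law of a vector of `n` independent signed Bernoulli entries. -/
def sbernVec (p : unitInterval) (n : ℕ) : Measure (Fin n → ℝ) :=
  Measure.pi fun _ => sbern p

/-- The convex hull of the matrices `c i (c i)ᵗ`. -/
def cutHull {r n : ℕ} (c : Fin r → Fin n → ℝ) : Set (Matrix (Fin n) (Fin n) ℝ) :=
  convexHull ℝ (Set.range fun i => Matrix.vecMulVec (c i) (c i))

/-- The random set `F` follows the model with parameters `p, r, n`: it is the convex hull of
`ξ₁ ξ₁ᵗ, …, ξᵣ ξᵣᵗ` for independent signed Bernoulli vectors `ξ₁, …, ξᵣ` in dimension `n`. -/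
def IsRandomFace {Ω : Type*} [MeasurableSpace Ω] (P : Measure Ω) (p : unitInterval) (r n : ℕ)
    (F : Ω → Set (Matrix (Fin n) (Fin n) ℝ)) : Prop :=
  ∃ ξ : Fin r → Ω → Fin n → ℝ,
    (∀ i, HasLaw (ξ i) (sbernVec p n) P) ∧ iIndepFun ξ P ∧
      ∀ ω, F ω = cutHull fun i => ξ i ω

end

/-! Write `C` for the matrix with rows `c i`; its columns are sign vectors in `{±1}^r`. Call the
columns generic if no nonzero form `c + ∑_{i<j} a_ij x_i x_j` vanishes on all of them.

Genericity forces a simplicial face (`ColumnsGeneric.isSimplicialFace`). If a point of the hull lies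
strictly between `X` and `Y` in the elliptope, positivity makes `X` vanish on `ker C`, so `X = Cᵀ A
C` with `A` positive semidefinite. The unit diagonal of `X` says that a form built from `A` minus
the constant `1` vanishes on every column. Hence `A` is diagonal with trace `1`, and `X` is in the
hull.

Genericity is likely (`sum_commonZeroIndicator_evalForm_le`). Reveal the columns one at a time and
let `K` be the space of forms vanishing so far. A fixed nonzero form survives a random column with
probability at most `1 - ρ`, and otherwise `dim K` drops. The potential `(1 - s)⁻¹ ^ (dim K - 1)`
thus shrinks by a factor `1 - ρ s` per column in expectation. It dominates the indicator of `K ≠ 0`,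
which gives the tail bound after tuning `ρ` and `s` to `r`. -/

open scoped Matrix

/-! ### Forms on the sign cube -/

/-- The ordered pairs `i < j` of elements of `Fin r`. -/
abbrev IncreasingPair (r : ℕ) := {q : Fin r × Fin r // q.1 < q.2}

/-- Coefficients of the functions `c + ∑ i < j, a i j * x i * x j` on the cube. -/
abbrev CubeForm (r : ℕ) := ℝ × (IncreasingPair r → ℝ)

/-- Evaluation of a form at a point. -/
noncomputable def evalForm {r : ℕ} (x : Fin r → ℝ) : CubeForm r →ₗ[ℝ] ℝ :=
  LinearMap.fst ℝ ℝ (IncreasingPair r → ℝ) +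
    (∑ q : IncreasingPair r, (x q.1.1 * x q.1.2) • LinearMap.proj q) ∘ₗ
      LinearMap.snd ℝ ℝ (IncreasingPair r → ℝ)

theorem evalForm_apply {r : ℕ} (x : Fin r → ℝ) (a : CubeForm r) :
    evalForm x a = a.1 + ∑ q : IncreasingPair r, a.2 q * (x q.1.1 * x q.1.2) := by
  simp [evalForm, mul_comm]

theorem sum_sum_eq_diag_add_increasing {r : ℕ} (f : Fin r → Fin r → ℝ) :
    ∑ i, ∑ j, f i j =
      ∑ i, f i i + ∑ q : IncreasingPair r, (f q.1.1 q.1.2 + f q.1.2 q.1.1) := by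
  have hd : ∑ i, f i i = ∑ i, ∑ j, if i = j then f i j else 0 := by simp
  have hq (g : Fin r → Fin r → ℝ) : ∑ q : IncreasingPair r, g q.1.1 q.1.2 =
      ∑ i, ∑ j, if i < j then g i j else 0 := by
    rw [← Fintype.sum_prod_type', ← Finset.sum_filter,
      Finset.sum_subtype (p := fun q : Fin r × Fin r => q.1 < q.2) _ (by simp)]
  rw [Finset.sum_add_distrib, hq f, hq fun i j => f j i, hd]
  rw [Finset.sum_comm (f := fun i j => if i < j then f j i else 0)]
  simp only [← Finset.sum_add_distrib]
  refine Finset.sum_congr rfl fun i _ => Finset.sum_congr rfl fun j _ => ?_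
  rcases lt_trichotomy i j with h | h | h
  · simp [h, h.ne, h.not_gt]
  · simp [h]
  · simp [h, h.ne', h.not_gt]

theorem card_increasingPair (r : ℕ) : 2 * Fintype.card (IncreasingPair r) + r = r ^ 2 := by
  have h := sum_sum_eq_diag_add_increasing (r := r) fun _ _ => 1
  simp at h
  have : (2 * Fintype.card (IncreasingPair r) + r : ℝ) = r ^ 2 := by
    rw [sq, h]; simp only [Fintype.card_subtype]; ring
  exact_mod_cast this

theorem finrank_cubeForm (r : ℕ) :
    Module.finrank ℝ (CubeForm r) = Fintype.card (IncreasingPair r) + 1 := by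
  simp [Module.finrank_prod, add_comm]

/-- On sign vectors the squares are `1`, so the diagonal of `M` only contributes its trace to the
constant term. -/
theorem sum_mul_mul_eq_evalForm {r : ℕ} (M : Matrix (Fin r) (Fin r) ℝ) {x : Fin r → ℝ}
    (hx : ∀ i, x i * x i = 1) :
    ∑ i, ∑ j, M i j * (x i * x j) =
      evalForm x (M.trace, fun q => M q.1.1 q.1.2 + M q.1.2 q.1.1) := by
  rw [sum_sum_eq_diag_add_increasing, evalForm_apply]
  simp only [hx, mul_one, Matrix.trace, Matrix.diag]
  congr 1
  exact Finset.sum_congr rfl fun q _ => by ring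

/-! ### Generic columns give simplicial faces -/

/-- The columns of `c` lie on the zero set of no nonzero form. -/
def ColumnsGeneric {r n : ℕ} (c : Fin r → Fin n → ℝ) : Prop :=
  ∀ a : CubeForm r, (∀ k, evalForm (fun i => c i k) a = 0) → a = 0

section Generic

variable {r n : ℕ} {c : Fin r → Fin n → ℝ}

theorem ColumnsGeneric.trace_and_offDiag (hg : ColumnsGeneric c) (hc : ∀ i k, c i k * c i k = 1)
    (M : Matrix (Fin r) (Fin r) ℝ) (t : ℝ)
    (hM : ∀ k, ∑ i, ∑ j, M i j * (c i k * c j k) = t) :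
    M.trace = t ∧ ∀ i j, i ≠ j → M i j + M j i = 0 := by
  have h := hg ((M.trace, fun q => M q.1.1 q.1.2 + M q.1.2 q.1.1) - (t, 0)) fun k => by
    rw [map_sub, ← sum_mul_mul_eq_evalForm M (fun i => hc i k), hM k, evalForm_apply]
    simp
  rw [sub_eq_zero, Prod.ext_iff] at h
  have h2 : ∀ i j, i < j → M i j + M j i = 0 := fun i j hij => congrFun h.2 ⟨(i, j), hij⟩
  refine ⟨h.1, fun i j hij => ?_⟩
  rcases lt_or_gt_of_ne hij with h' | h'
  · exact h2 i j h'
  · rw [add_comm]; exact h2 j i h'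

/-- Multiplying a relation `∑ g j • c j = 0` entrywise by `c i₀` gives a form that vanishes on all
columns and has constant term `g i₀`. -/
theorem ColumnsGeneric.linearIndependent (hg : ColumnsGeneric c)
    (hc : ∀ i k, c i k * c i k = 1) : LinearIndependent ℝ c := by
  rw [Fintype.linearIndependent_iff]
  intro g hgs i₀
  have h := (hg.trace_and_offDiag hc (Matrix.of fun i j => if i = i₀ then g j else 0) 0
    fun k => by
      have := congrFun hgs k
      simp only [Finset.sum_apply, Pi.smul_apply, smul_eq_mul, Pi.zero_apply] at this
      simp only [Matrix.of_apply, ite_mul, zero_mul]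
      rw [Finset.sum_comm]
      simp only [Finset.sum_ite_eq', Finset.mem_univ, if_true]
      calc ∑ j, g j * (c i₀ k * c j k) = c i₀ k * ∑ j, g j * c j k := by
            rw [Finset.mul_sum]; exact Finset.sum_congr rfl fun j _ => by ring
        _ = 0 := by rw [this, mul_zero]).1
  simpa [Matrix.trace] using h

theorem exists_left_inverse_transpose (h : LinearIndependent ℝ c) :
    ∃ L : Matrix (Fin r) (Fin n) ℝ, L * (Matrix.of c).transpose = 1 := by
  have hinj : Function.Injective (Matrix.of c).transpose.mulVec := by
    rw [Matrix.mulVec_injective_iff]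
    exact h
  obtain ⟨g, hg⟩ := LinearMap.exists_leftInverse_of_injective
    (Matrix.mulVecLin (Matrix.of c).transpose) (LinearMap.ker_eq_bot.2 hinj)
  refine ⟨LinearMap.toMatrix' g, ?_⟩
  have h1 := congrArg LinearMap.toMatrix' hg
  rwa [LinearMap.toMatrix'_comp, LinearMap.toMatrix'_id, ← Matrix.toLin'_apply',
    LinearMap.toMatrix'_toLin'] at h1

theorem transpose_mul_mul_eq_sum (M : Matrix (Fin r) (Fin r) ℝ) (k l : Fin n) :
    ((Matrix.of c).transpose * M * Matrix.of c) k l = ∑ i, ∑ j, M i j * (c i k * c j l) := by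
  simp only [Matrix.mul_apply, Matrix.transpose_apply, Matrix.of_apply, Finset.sum_mul]
  rw [Finset.sum_comm]
  exact Finset.sum_congr rfl fun i _ => Finset.sum_congr rfl fun j _ => by ring

theorem sum_smul_vecMulVec_eq (w : Fin r → ℝ) :
    ∑ i, w i • Matrix.vecMulVec (c i) (c i) =
      (Matrix.of c).transpose * Matrix.diagonal w * Matrix.of c := by
  ext k l
  rw [transpose_mul_mul_eq_sum]
  simp [Matrix.sum_apply, Matrix.vecMulVec_apply, Matrix.diagonal_apply]

/-- A left inverse of `Cᵀ` recovers `diagonal g` from `Cᵀ (diagonal g) C`. -/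
theorem linearIndependent_vecMulVec (h : LinearIndependent ℝ c) :
    LinearIndependent ℝ fun i => Matrix.vecMulVec (c i) (c i) := by
  obtain ⟨L, hL⟩ := exists_left_inverse_transpose h
  rw [Fintype.linearIndependent_iff]
  intro g hg i
  rw [sum_smul_vecMulVec_eq] at hg
  have hL' : Matrix.of c * L.transpose = 1 := by
    simpa using congrArg Matrix.transpose hL
  have : Matrix.diagonal g = 0 := by
    calc Matrix.diagonal g = (L * (Matrix.of c).transpose) * Matrix.diagonal g *
          (Matrix.of c * L.transpose) := by rw [hL, hL', one_mul, mul_one]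
      _ = L * ((Matrix.of c).transpose * Matrix.diagonal g * Matrix.of c) * L.transpose := by
          simp only [Matrix.mul_assoc]
      _ = 0 := by rw [hg]; simp
  simpa using congrFun (congrFun this i) i

theorem convex_elliptope (n : ℕ) : Convex ℝ (elliptope n) := by
  rintro X ⟨hX, hX1⟩ Y ⟨hY, hY1⟩ a b ha hb hab
  refine ⟨(hX.smul ha).add (hY.smul hb), fun i => ?_⟩
  simp [hX1, hY1, hab]

theorem vecMulVec_mem_elliptope {v : Fin n → ℝ} (hv : ∀ k, v k * v k = 1) :
    Matrix.vecMulVec v v ∈ elliptope n := by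
  refine ⟨?_, fun i => by simp [Matrix.vecMulVec_apply, hv]⟩
  simpa using Matrix.posSemidef_vecMulVec_self_star v

theorem mem_cutHull_iff {X : Matrix (Fin n) (Fin n) ℝ} : X ∈ cutHull c ↔
    ∃ w : Fin r → ℝ, (∀ i, 0 ≤ w i) ∧ ∑ i, w i = 1 ∧
      X = (Matrix.of c).transpose * Matrix.diagonal w * Matrix.of c := by
  have h := LinearMap.image_convexHull
    (Fintype.linearCombination ℝ fun i => Matrix.vecMulVec (c i) (c i))
    (Set.range fun i => Pi.single i (1 : ℝ))
  rw [convexHull_rangle_single_eq_stdSimplex, ← Set.range_comp] at h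
  have hcomp : (Fintype.linearCombination ℝ fun i => Matrix.vecMulVec (c i) (c i)) ∘
      (fun i => Pi.single i (1 : ℝ)) = fun i => Matrix.vecMulVec (c i) (c i) := by
    ext1 i
    simp [Fintype.linearCombination_apply_single]
  rw [cutHull, ← hcomp, ← h]
  constructor
  · rintro ⟨w, ⟨hw0, hw1⟩, rfl⟩
    exact ⟨w, hw0, hw1, by rw [Fintype.linearCombination_apply, sum_smul_vecMulVec_eq]⟩
  · rintro ⟨w, hw0, hw1, rfl⟩
    exact ⟨w, ⟨hw0, hw1⟩, by rw [Fintype.linearCombination_apply, sum_smul_vecMulVec_eq]⟩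

/-- A positive semidefinite matrix dominated on a segment by a combination of the `c i (c i)ᵗ`
vanishes on the orthogonal complement of the `c i`. -/
theorem mulVec_eq_zero_of_combination {X Y : Matrix (Fin n) (Fin n) ℝ} (hX : X.PosSemidef)
    (hY : Y.PosSemidef) {a b : ℝ} (ha : 0 < a) (hb : 0 < b) {w : Fin r → ℝ}
    (h : a • X + b • Y = (Matrix.of c).transpose * Matrix.diagonal w * Matrix.of c)
    {u : Fin n → ℝ} (hu : Matrix.of c *ᵥ u = 0) : X *ᵥ u = 0 := by
  have h0 : a * (u ⬝ᵥ X *ᵥ u) + b * (u ⬝ᵥ Y *ᵥ u) = 0 := by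
    have : u ⬝ᵥ (a • X + b • Y) *ᵥ u = 0 := by
      rw [h, ← Matrix.mulVec_mulVec, hu]; simp
    simpa [Matrix.add_mulVec, Matrix.smul_mulVec, dotProduct_add] using this
  have hXu : 0 ≤ u ⬝ᵥ X *ᵥ u := by simpa using hX.dotProduct_mulVec_nonneg u
  have hYu : 0 ≤ u ⬝ᵥ Y *ᵥ u := by simpa using hY.dotProduct_mulVec_nonneg u
  have : u ⬝ᵥ X *ᵥ u = 0 := by
    have := mul_nonneg hb.le hYu
    have h1 : a * (u ⬝ᵥ X *ᵥ u) ≤ 0 := by linarith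
    exact le_antisymm (nonpos_of_mul_nonpos_right h1 ha) hXu
  exact (hX.dotProduct_mulVec_zero_iff u).1 (by simpa using this)

theorem ColumnsGeneric.isExtreme (hg : ColumnsGeneric c) (hc : ∀ i k, c i k * c i k = 1) :
    IsExtreme ℝ (elliptope n) (cutHull c) := by
  refine ⟨convexHull_min ?_ (convex_elliptope n), ?_⟩
  · rintro _ ⟨i, rfl⟩
    exact vecMulVec_mem_elliptope (hc i)
  rintro X ⟨hX, hX1⟩ Y ⟨hY, -⟩ Z hZ ⟨a, b, ha, hb, -, rfl⟩
  obtain ⟨w, -, -, hw⟩ := mem_cutHull_iff.1 hZ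
  obtain ⟨L, hL⟩ := exists_left_inverse_transpose (hg.linearIndependent hc)
  set B := (Matrix.of c).transpose with hB
  have hL' : Matrix.of c * L.transpose = 1 := by simpa [hB] using congrArg Matrix.transpose hL
  have hXt : X.transpose = X := by simpa using hX.1.eq
  -- `Lᵀ C` is a projection with the same kernel as `C`: since `C Lᵀ = 1`, the range of `1 - Lᵀ C`
  -- lies in `ker C`, where `X` vanishes.
  have hXQ : X = X * (L.transpose * Matrix.of c) := by
    rw [← sub_eq_zero, show X - X * (L.transpose * Matrix.of c) =
      X * (1 - L.transpose * Matrix.of c) by rw [Matrix.mul_sub, Matrix.mul_one]]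
    refine Matrix.ext_of_mulVec_single fun i => ?_
    rw [← Matrix.mulVec_mulVec, Matrix.zero_mulVec]
    refine mulVec_eq_zero_of_combination hX hY ha hb hw ?_
    rw [Matrix.mulVec_mulVec, Matrix.mul_sub, ← Matrix.mul_assoc, hL', Matrix.mul_one, Matrix.one_mul,
      sub_self, Matrix.zero_mulVec]
  have hXQ' : X = B * L * X := by
    have := congrArg Matrix.transpose hXQ
    rwa [Matrix.transpose_mul, Matrix.transpose_mul, Matrix.transpose_transpose, hXt] at this
  have hXA : X = B * (L * X * L.transpose) * Matrix.of c := by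
    conv_lhs => rw [hXQ', hXQ]
    simp only [Matrix.mul_assoc]
  have hA : (L * X * L.transpose).PosSemidef := by
    simpa using hX.mul_mul_conjTranspose_same L
  set A := L * X * L.transpose
  -- The unit diagonal of `X` is the only elliptope condition needed besides positivity. Genericity
  -- gives `A i j + A j i = 0` off the diagonal, and symmetry then gives `A i j = 0`.
  obtain ⟨htr, hoff⟩ := hg.trace_and_offDiag hc A 1 fun k => by
    rw [← transpose_mul_mul_eq_sum, ← hB, ← hXA, hX1]
  refine mem_cutHull_iff.2 ⟨A.diag, fun i => hA.diag_nonneg, htr, ?_⟩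
  rw [← hB, ← show A = Matrix.diagonal A.diag from ?_]
  · exact hXA
  · ext i j
    rcases eq_or_ne i j with rfl | hij
    · simp
    · have h1 := hoff i j hij
      have h2 : A j i = A i j := by simpa using hA.1.apply i j
      rw [Matrix.diagonal_apply_ne _ hij]
      linarith

theorem ColumnsGeneric.isSimplicialFace (hr : 1 ≤ r) (hg : ColumnsGeneric c)
    (hc : ∀ i k, c i k * c i k = 1) : IsSimplicialFace (elliptope n) (cutHull c) (r - 1) := by
  have hai : AffineIndependent ℝ fun i => Matrix.vecMulVec (c i) (c i) :=
    (linearIndependent_vecMulVec (hg.linearIndependent hc)).affineIndependent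
  have hr' : r - 1 + 1 = r := Nat.sub_add_cancel hr
  refine ⟨⟨convex_convexHull _ _, hg.isExtreme hc⟩, ?_, ?_⟩
  · rw [convexDim, cutHull, affineSpan_convexHull, direction_affineSpan]
    exact hai.finrank_vectorSpan (by simp [hr'])
  · refine ⟨_, hai.comp_embedding (finCongr hr').toEmbedding, ?_⟩
    rw [cutHull]
    congr 1
    exact ((finCongr hr').surjective.range_comp _).symm

end Generic

/-! ### Potential argument for common zeros of random functionals -/

section Potential

variable {α A : Type*} [AddCommGroup A] [Module ℝ A]

open Classical in
/-- The potential `t ^ (dim K - 1)` of a nonzero subspace; the zero subspace has potential `0`. -/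
noncomputable def dimPotential (t : ℝ) (K : Submodule ℝ A) : ℝ :=
  if K = ⊥ then 0 else t ^ (Module.finrank ℝ K - 1)

open Classical in
/-- The indicator of the existence of a nonzero element of `K` killed by all `ev (y k)`. -/
noncomputable def commonZeroIndicator (ev : α → A →ₗ[ℝ] ℝ) (K : Submodule ℝ A) {n : ℕ}
    (y : Fin n → α) : ℝ :=
  if ∃ a ∈ K, a ≠ 0 ∧ ∀ k, ev (y k) a = 0 then 1 else 0

/-- The recursion behind the induction: revealing one point cuts `K` by the kernel of its
evaluation. -/
theorem commonZeroIndicator_cons (ev : α → A →ₗ[ℝ] ℝ) (K : Submodule ℝ A) {n : ℕ}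
    (x : α) (y : Fin n → α) :
    commonZeroIndicator ev K (Fin.cons x y : Fin (n + 1) → α) =
      commonZeroIndicator ev (K ⊓ LinearMap.ker (ev x)) y := by
  unfold commonZeroIndicator
  congr 1
  simp only [Fin.forall_fin_succ, Fin.cons_zero, Fin.cons_succ, Submodule.mem_inf,
    LinearMap.mem_ker, eq_iff_iff]
  exact exists_congr fun a => by tauto

theorem dimPotential_nonneg {t : ℝ} (ht : 1 ≤ t) (K : Submodule ℝ A) : 0 ≤ dimPotential t K := by
  unfold dimPotential
  split_ifs <;> positivity

variable [FiniteDimensional ℝ A]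

theorem dimPotential_inf_le {t : ℝ} (ht : 1 ≤ t) {K L : Submodule ℝ A} (h : ¬ K ≤ L) :
    dimPotential t (K ⊓ L) ≤ t⁻¹ * dimPotential t K := by
  have hK : K ≠ ⊥ := fun hK => h (hK ▸ bot_le)
  have ht0 : 0 < t := by linarith
  by_cases hKL : K ⊓ L = ⊥
  · have := dimPotential_nonneg ht K
    rw [dimPotential, if_pos hKL]
    positivity
  rw [dimPotential, dimPotential, if_neg hKL, if_neg hK]
  have h1 : Module.finrank ℝ ↥(K ⊓ L) < Module.finrank ℝ K :=
    Submodule.finrank_lt_finrank_of_lt (inf_le_left.lt_of_ne fun e => h (inf_eq_left.1 e))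
  have h2 : 0 < Module.finrank ℝ ↥(K ⊓ L) := by
    rw [Nat.pos_iff_ne_zero, Ne, Submodule.finrank_eq_zero]; exact hKL
  rw [inv_mul_eq_div, le_div_iff₀ ht0, ← pow_succ]
  exact pow_le_pow_right₀ ht (by omega)

variable [Fintype α]

open Classical in
-- One fixed nonzero `a ∈ K` suffices as a witness: whenever `ev x a ≠ 0`, the space `K` strictly
-- shrinks and the potential loses a factor `1 - s`; otherwise it does not grow.
theorem sum_dimPotential_inf_ker_le (w : α → ℝ) (hw0 : ∀ x, 0 ≤ w x) (hw1 : ∑ x, w x = 1)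
    (ev : α → A →ₗ[ℝ] ℝ) {ρ s : ℝ} (hs0 : 0 ≤ s) (hs1 : s < 1)
    (hρ : ∀ a, a ≠ 0 → ρ ≤ ∑ x, w x * if ev x a = 0 then 0 else 1) (K : Submodule ℝ A) :
    ∑ x, w x * dimPotential (1 - s)⁻¹ (K ⊓ LinearMap.ker (ev x)) ≤
      (1 - ρ * s) * dimPotential (1 - s)⁻¹ K := by
  by_cases hK : K = ⊥
  · simp [hK, dimPotential]
  obtain ⟨a, haK, ha⟩ := K.ne_bot_iff.1 hK
  have ht : 1 ≤ (1 - s)⁻¹ := (one_le_inv₀ (by linarith)).2 (by linarith)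
  have hφ := dimPotential_nonneg ht K
  set φ := dimPotential (1 - s)⁻¹ K
  calc ∑ x, w x * dimPotential (1 - s)⁻¹ (K ⊓ LinearMap.ker (ev x))
      ≤ ∑ x, (w x * φ - (w x * if ev x a = 0 then 0 else 1) * (s * φ)) := by
        refine Finset.sum_le_sum fun x _ => ?_
        by_cases hx : K ≤ LinearMap.ker (ev x)
        · have hxa : ev x a = 0 := hx haK
          rw [inf_eq_left.2 hx, if_pos hxa]
          simp [φ]
        · have h1 := mul_le_mul_of_nonneg_left (dimPotential_inf_le ht hx) (hw0 x)
          rw [inv_inv] at h1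
          refine h1.trans ?_
          have h2 : 0 ≤ w x * (s * φ) := by have := hw0 x; positivity
          split_ifs
          · change w x * ((1 - s) * φ) ≤ _
            linarith
          · change w x * ((1 - s) * φ) ≤ _
            linarith
    _ = φ - (∑ x, w x * if ev x a = 0 then 0 else 1) * (s * φ) := by
        rw [Finset.sum_sub_distrib, ← Finset.sum_mul, ← Finset.sum_mul, hw1, one_mul]
    _ ≤ φ - ρ * (s * φ) := by
        have := mul_le_mul_of_nonneg_right (hρ a ha) (mul_nonneg hs0 hφ)
        linarith
    _ = (1 - ρ * s) * φ := by ring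

open Classical in
theorem sum_commonZeroIndicator_le (w : α → ℝ) (hw0 : ∀ x, 0 ≤ w x) (hw1 : ∑ x, w x = 1)
    (ev : α → A →ₗ[ℝ] ℝ) {ρ s : ℝ} (hs0 : 0 ≤ s) (hs1 : s < 1) (hρs : ρ * s ≤ 1)
    (hρ : ∀ a, a ≠ 0 → ρ ≤ ∑ x, w x * if ev x a = 0 then 0 else 1) (n : ℕ)
    (K : Submodule ℝ A) :
    ∑ y : Fin n → α, (∏ k, w (y k)) * commonZeroIndicator ev K y ≤
      (1 - ρ * s) ^ n * dimPotential (1 - s)⁻¹ K := by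
  have ht : 1 ≤ (1 - s)⁻¹ := (one_le_inv₀ (by linarith)).2 (by linarith)
  induction n generalizing K with
  | zero =>
    simp only [Fintype.sum_unique, Finset.univ_eq_empty, Finset.prod_empty, one_mul, pow_zero]
    unfold commonZeroIndicator
    split_ifs with h
    -- With no points left, the indicator is `1` only for `K ≠ ⊥`, where the potential is at least
    -- `1`.
    · obtain ⟨a, haK, ha, -⟩ := h
      rw [dimPotential, if_neg (K.ne_bot_iff.2 ⟨a, haK, ha⟩)]
      exact one_le_pow₀ ht
    · exact dimPotential_nonneg ht K
  | succ n ih =>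
    rw [← (Fin.consEquiv fun _ => α).sum_comp, Fintype.sum_prod_type]
    calc _ = ∑ x, w x * ∑ y : Fin n → α, (∏ k, w (y k)) *
            commonZeroIndicator ev (K ⊓ LinearMap.ker (ev x)) y := by
          refine Finset.sum_congr rfl fun x _ => ?_
          rw [Finset.mul_sum]
          refine Finset.sum_congr rfl fun y _ => ?_
          change (∏ k, w ((Fin.cons x y : Fin (n + 1) → α) k)) *
            commonZeroIndicator ev K (Fin.cons x y : Fin (n + 1) → α) = _
          rw [commonZeroIndicator_cons, Fin.prod_univ_succ]
          simp only [Fin.cons_zero, Fin.cons_succ, mul_assoc]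
      _ ≤ ∑ x, w x * ((1 - ρ * s) ^ n *
            dimPotential (1 - s)⁻¹ (K ⊓ LinearMap.ker (ev x))) :=
          Finset.sum_le_sum fun x _ => mul_le_mul_of_nonneg_left (ih _) (hw0 x)
      _ = (1 - ρ * s) ^ n *
            ∑ x, w x * dimPotential (1 - s)⁻¹ (K ⊓ LinearMap.ker (ev x)) := by
          rw [Finset.mul_sum]; exact Finset.sum_congr rfl fun x _ => by ring
      _ ≤ (1 - ρ * s) ^ n * ((1 - ρ * s) * dimPotential (1 - s)⁻¹ K) :=
          mul_le_mul_of_nonneg_left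
            (sum_dimPotential_inf_ker_le w hw0 hw1 ev hs0 hs1 hρ K)
            (pow_nonneg (by linarith) n)
      _ = _ := by ring

open Classical in
theorem sum_commonZeroIndicator_top_le (w : α → ℝ) (hw0 : ∀ x, 0 ≤ w x) (hw1 : ∑ x, w x = 1)
    (ev : α → A →ₗ[ℝ] ℝ) {ρ s : ℝ} (hs0 : 0 ≤ s) (hs1 : s < 1) (hρs : ρ * s ≤ 1)
    (hρ : ∀ a, a ≠ 0 → ρ ≤ ∑ x, w x * if ev x a = 0 then 0 else 1) (n : ℕ) :
    ∑ y : Fin n → α, (∏ k, w (y k)) * commonZeroIndicator ev ⊤ y ≤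
      (1 - s)⁻¹ ^ (Module.finrank ℝ A - 1) * Real.exp (-(ρ * s * n)) := by
  have ht : 1 ≤ (1 - s)⁻¹ := (one_le_inv₀ (by linarith)).2 (by linarith)
  refine (sum_commonZeroIndicator_le w hw0 hw1 ev hs0 hs1 hρs hρ n ⊤).trans ?_
  rw [mul_comm]
  have h1 : dimPotential (1 - s)⁻¹ (⊤ : Submodule ℝ A) ≤
      (1 - s)⁻¹ ^ (Module.finrank ℝ A - 1) := by
    unfold dimPotential
    split_ifs
    · positivity
    · rw [finrank_top]
  have h2 : (1 - ρ * s) ^ n ≤ Real.exp (-(ρ * s * n)) := by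
    calc (1 - ρ * s) ^ n ≤ Real.exp (-(ρ * s)) ^ n :=
          pow_le_pow_left₀ (by linarith) (Real.one_sub_le_exp_neg _) n
      _ = _ := by rw [← Real.exp_nat_mul]; congr 1; ring
  exact mul_le_mul h1 h2 (pow_nonneg (by linarith) n) (by positivity)

end Potential

/-! ### Resampling coordinates under a product weight -/

section Resampling

variable {ι β : Type*} [Fintype ι] [DecidableEq ι]

theorem prod_update_mul (w : β → ℝ) (x : ι → β) (i : ι) (b : β) :
    (∏ k, w (Function.update x i b k)) * w (x i) = (∏ k, w (x k)) * w b := by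
  rw [← Finset.mul_prod_erase _ _ (Finset.mem_univ i),
    ← Finset.mul_prod_erase _ (fun k => w (x k)) (Finset.mem_univ i), Function.update_self]
  rw [Finset.prod_congr rfl (g := fun k => w (x k)) fun k hk => by
    rw [Function.update_of_ne (Finset.ne_of_mem_erase hk)]]
  ring

variable [Fintype β]

/-- Resampling one coordinate does not change an expectation under a product weight. -/
theorem sum_prod_mul_resample (w : β → ℝ) (hw1 : ∑ b, w b = 1) (i : ι) (g : (ι → β) → ℝ) :
    ∑ x : ι → β, (∏ k, w (x k)) * ∑ b, w b * g (Function.update x i b) =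
      ∑ x : ι → β, (∏ k, w (x k)) * g x := by
  -- Swapping the coordinate `x i` with the fresh sample `b` is an involution preserving the joint
  -- weight.
  have hinv : Function.Involutive
      fun z : (ι → β) × β => (Function.update z.1 i z.2, z.1 i) := by
    rintro ⟨x, b⟩
    simp
  calc _ = ∑ z : (ι → β) × β, (∏ k, w (z.1 k)) * w z.2 * g (Function.update z.1 i z.2) := by
        rw [Fintype.sum_prod_type]
        simp only [Finset.mul_sum, mul_assoc]
    _ = ∑ z : (ι → β) × β, (∏ k, w (z.1 k)) * w z.2 * g z.1 := by
        rw [← Equiv.sum_comp hinv.toPerm]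
        refine Finset.sum_congr rfl fun z _ => ?_
        simp only [Function.Involutive.coe_toPerm, prod_update_mul, Function.update_idem,
          Function.update_eq_self]
    _ = _ := by
        rw [Fintype.sum_prod_type]
        refine Finset.sum_congr rfl fun x _ => ?_
        simp only [mul_right_comm _ _ (g x)]
        rw [← Finset.mul_sum, hw1, mul_one]

theorem sum_prod_eq_one (w : β → ℝ) (hw1 : ∑ b, w b = 1) :
    ∑ x : ι → β, ∏ k, w (x k) = 1 := by
  have := Finset.prod_univ_sum (fun _ : ι => (Finset.univ : Finset β)) fun _ b => w b
  simpa [hw1, Fintype.piFinset_univ] using this.symm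

theorem le_sum_prod_mul_of_resample (w : β → ℝ) (hw0 : ∀ b, 0 ≤ w b) (hw1 : ∑ b, w b = 1)
    (i : ι) (g : (ι → β) → ℝ) {ρ : ℝ}
    (h : ∀ x, ρ ≤ ∑ b, w b * g (Function.update x i b)) :
    ρ ≤ ∑ x : ι → β, (∏ k, w (x k)) * g x := by
  rw [← sum_prod_mul_resample w hw1 i g]
  calc ρ = ∑ x : ι → β, (∏ k, w (x k)) * ρ := by
        rw [← Finset.sum_mul, sum_prod_eq_one w hw1, one_mul]
    _ ≤ _ := Finset.sum_le_sum fun x _ =>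
        mul_le_mul_of_nonneg_left (h x) (Finset.prod_nonneg fun k _ => hw0 _)

theorem le_sum_prod_mul_of_resample_two (w : β → ℝ) (hw0 : ∀ b, 0 ≤ w b) (hw1 : ∑ b, w b = 1)
    (i j : ι) (g : (ι → β) → ℝ) {ρ : ℝ}
    (h : ∀ x, ρ ≤ ∑ b, w b * ∑ b', w b' * g (Function.update (Function.update x i b) j b')) :
    ρ ≤ ∑ x : ι → β, (∏ k, w (x k)) * g x := by
  rw [← sum_prod_mul_resample w hw1 j g]
  exact le_sum_prod_mul_of_resample w hw0 hw1 i _ h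

end Resampling

/-! ### Nonvanishing probability of a form at a random sign vector -/

/-- The sign encoded by a Boolean. -/
def boolSign (b : Bool) : ℝ := if b then 1 else -1

/-- The Bernoulli weight on `Bool`. -/
def boolWeight (p : ℝ) (b : Bool) : ℝ := if b then p else 1 - p

theorem boolSign_mul_self (b : Bool) : boolSign b * boolSign b = 1 := by
  cases b <;> simp [boolSign]

theorem sum_boolWeight (p : ℝ) : ∑ b, boolWeight p b = 1 := by simp [boolWeight]

theorem boolWeight_nonneg {p : ℝ} (hp0 : 0 ≤ p) (hp1 : p ≤ 1) (b : Bool) : 0 ≤ boolWeight p b := by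
  cases b <;> simp [boolWeight, hp0, hp1]

theorem mul_one_sub_le_boolWeight {p : ℝ} (hp0 : 0 ≤ p) (hp1 : p ≤ 1) (b : Bool) :
    p * (1 - p) ≤ boolWeight p b := by
  cases b <;> simp only [boolWeight] <;> simp <;> nlinarith

open Classical in
-- With the other coordinates frozen, the mixed second difference in `x i` and `x j` is `4 * a i j ≠
-- 0`. So one of the four sign choices gives a nonzero value, and each choice has weight at least
-- `(p * (1 - p)) ^ 2`.
theorem le_prob_evalForm_ne_zero_of_coeff_ne_zero {p : ℝ} (hp0 : 0 ≤ p) (hp1 : p ≤ 1)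
    {r : ℕ} (a : CubeForm r) (q : IncreasingPair r) (hq : a.2 q ≠ 0) :
    (p * (1 - p)) ^ 2 ≤ ∑ x : Fin r → Bool, (∏ i, boolWeight p (x i)) *
      if evalForm (fun i => boolSign (x i)) a = 0 then 0 else 1 := by
  obtain ⟨⟨i, j⟩, hij⟩ := q
  refine le_sum_prod_mul_of_resample_two _ (boolWeight_nonneg hp0 hp1) (sum_boolWeight p) i j _
    fun x => ?_
  set h : Bool → Bool → ℝ := fun b b' => evalForm
    (fun k => boolSign (Function.update (Function.update x i b) j b' k)) a with h_def
  have hdiff : h true true - h true false - h false true + h false false =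
      4 * a.2 ⟨(i, j), hij⟩ := by
    simp only [h_def, evalForm_apply]
    have : ∀ c s₁ s₂ s₃ s₄ : ℝ, c + s₁ - (c + s₂) - (c + s₃) + (c + s₄) = s₁ - s₂ - s₃ + s₄ := by
      intros; ring
    rw [this, ← Finset.sum_sub_distrib, ← Finset.sum_sub_distrib, ← Finset.sum_add_distrib,
      Finset.sum_eq_single ⟨(i, j), hij⟩ _ (by simp)]
    · have hne : i ≠ j := ne_of_lt hij
      simp [boolSign, hne]
      ring
    · rintro ⟨⟨k, l⟩, hkl⟩ - hne
      have hne' : ¬ (k = i ∧ l = j) := fun e => hne (by simp [e.1, e.2])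
      have hij' : i < j := hij
      have hkl' : k < l := hkl
      simp only [Function.update_apply]
      by_cases h1 : k = j
      · have h2 : l ≠ i := by rintro rfl; exact absurd (h1 ▸ hkl') hij'.not_gt
        have h3 : l ≠ j := by rintro rfl; exact absurd h1 hkl'.ne
        simp [h1, h2, h3]
      · by_cases h2 : k = i
        · have h3 : l ≠ j := fun e => hne' ⟨h2, e⟩
          have h4 : l ≠ i := by rintro rfl; exact absurd h2 hkl'.ne
          simp [h2, h3, h4, hij'.ne]
        · by_cases h3 : l = j
          · simp [h1, h2, h3]
          · simp [h1, h2, h3]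
  obtain ⟨b, b', hb⟩ : ∃ b b', h b b' ≠ 0 := by
    by_contra! hcon
    simp only [hcon] at hdiff
    exact hq (by linarith)
  have hw := boolWeight_nonneg hp0 hp1
  have hpq : 0 ≤ p * (1 - p) := mul_nonneg hp0 (by linarith)
  have hind : ∀ z : ℝ, (0 : ℝ) ≤ if z = 0 then 0 else 1 := fun z => by split_ifs <;> simp
  calc (p * (1 - p)) ^ 2 = (p * (1 - p)) * (p * (1 - p)) := sq _
    _ ≤ boolWeight p b * (boolWeight p b' * if h b b' = 0 then 0 else 1) := by
        rw [if_neg hb, mul_one]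
        exact mul_le_mul (mul_one_sub_le_boolWeight hp0 hp1 b)
          (mul_one_sub_le_boolWeight hp0 hp1 b') hpq (hw b)
    _ ≤ boolWeight p b * ∑ b', boolWeight p b' * if h b b' = 0 then 0 else 1 :=
        mul_le_mul_of_nonneg_left (Finset.single_le_sum
          (f := fun b' => boolWeight p b' * if h b b' = 0 then 0 else 1)
          (fun b' _ => mul_nonneg (hw b') (hind _)) (Finset.mem_univ b')) (hw b)
    _ ≤ _ := Finset.single_le_sum
          (f := fun b => boolWeight p b * ∑ b', boolWeight p b' * if h b b' = 0 then 0 else 1)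
          (fun b _ => mul_nonneg (hw b) (Finset.sum_nonneg fun b' _ =>
            mul_nonneg (hw b') (hind _))) (Finset.mem_univ b)

open Classical in
theorem prob_evalForm_ne_zero_of_coeff_eq_zero (p : ℝ) {r : ℕ} (a : CubeForm r)
    (ha : a ≠ 0) (h : a.2 = 0) : ∑ x : Fin r → Bool, (∏ i, boolWeight p (x i)) *
      (if evalForm (fun i => boolSign (x i)) a = 0 then 0 else 1) = 1 := by
  have h1 : a.1 ≠ 0 := fun h1 => ha (Prod.ext h1 h)
  simp [evalForm_apply, h, h1, sum_prod_eq_one _ (sum_boolWeight p)]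

open Classical in
theorem sq_le_prob_evalForm_ne_zero {p : ℝ} (hp0 : 0 ≤ p) (hp1 : p ≤ 1)
    {r : ℕ} (a : CubeForm r) (ha : a ≠ 0) :
    (p * (1 - p)) ^ 2 ≤ ∑ x : Fin r → Bool, (∏ i, boolWeight p (x i)) *
      if evalForm (fun i => boolSign (x i)) a = 0 then 0 else 1 := by
  by_cases h : a.2 = 0
  · rw [prob_evalForm_ne_zero_of_coeff_eq_zero p a ha h]
    exact pow_le_one₀ (mul_nonneg hp0 (by linarith)) (by nlinarith)
  · obtain ⟨q, hq⟩ := Function.ne_iff.1 h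
    exact le_prob_evalForm_ne_zero_of_coeff_ne_zero hp0 hp1 a q hq

open Classical in
-- The form is `a + b * x 0 * x 1`, so flipping `x 0` alone already yields a nonzero value. The
-- general squared bound would be too weak for `r = 2`.
theorem mul_le_prob_evalForm_two_ne_zero {p : ℝ} (hp0 : 0 ≤ p) (hp1 : p ≤ 1)
    (a : CubeForm 2) (ha : a ≠ 0) :
    p * (1 - p) ≤ ∑ x : Fin 2 → Bool, (∏ i, boolWeight p (x i)) *
      if evalForm (fun i => boolSign (x i)) a = 0 then 0 else 1 := by
  have huniq : ∀ q : IncreasingPair 2, q = ⟨(0, 1), by simp⟩ := by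
    rintro ⟨⟨i, j⟩, hij⟩
    have h : (i : ℕ) < j := hij
    have hi : i = 0 := by ext; simp; omega
    have hj : j = 1 := by ext; simp; omega
    subst hi hj
    rfl
  have hev : ∀ x : Fin 2 → ℝ, evalForm x a = a.1 + a.2 ⟨(0, 1), by simp⟩ * (x 0 * x 1) := by
    intro x
    rw [evalForm_apply, Finset.sum_eq_single ⟨(0, 1), by simp⟩ (fun q _ hq => absurd (huniq q) hq)
      (by simp)]
  refine le_sum_prod_mul_of_resample _ (boolWeight_nonneg hp0 hp1) (sum_boolWeight p) 0 _
    fun x => ?_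
  have hw := boolWeight_nonneg hp0 hp1
  obtain ⟨b, hb⟩ : ∃ b, evalForm (fun k => boolSign (Function.update x 0 b k)) a ≠ 0 := by
    by_contra! hcon
    have ht := hcon true
    have hf := hcon false
    simp only [hev, Function.update_self, Function.update_of_ne (one_ne_zero : (1 : Fin 2) ≠ 0)]
      at ht hf
    have hs := boolSign_mul_self (x 1)
    simp only [boolSign, if_true, Bool.false_eq_true, if_false] at ht hf hs
    set s : ℝ := if x 1 = true then 1 else -1
    have h1 : a.1 = 0 := by linarith
    have h2 : a.2 ⟨(0, 1), by simp⟩ = 0 := by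
      have : a.2 ⟨(0, 1), by simp⟩ * s = 0 := by linarith
      rcases mul_eq_zero.1 this with h | h
      · exact h
      · simp [h] at hs
    exact ha (Prod.ext h1 (funext fun q => by rw [huniq q]; exact h2))
  refine (mul_one_sub_le_boolWeight hp0 hp1 b).trans ?_
  refine le_trans ?_ (Finset.single_le_sum (fun b _ => mul_nonneg (hw b) ?_) (Finset.mem_univ b))
  · rw [if_neg hb, mul_one]
  · split_ifs <;> simp

/-! ### Tuning the constants -/

theorem sum_commonZeroIndicator_evalForm_le {p : ℝ} (hp0 : 0 ≤ p) (hp1 : p ≤ 1)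
    {r : ℕ} (hr : 1 ≤ r) (n : ℕ) :
    ∑ y : Fin n → Fin r → Bool, (∏ k, ∏ i, boolWeight p (y k i)) *
        commonZeroIndicator (fun x : Fin r → Bool => evalForm fun i => boolSign (x i)) ⊤ y ≤
      (r : ℝ) ^ 2 * Real.exp (-(4 * p ^ 2 * (1 - p) ^ 2 * n) / (r : ℝ) ^ 2) := by
  classical
  have hW0 : ∀ x : Fin r → Bool, 0 ≤ ∏ i, boolWeight p (x i) := fun x =>
    Finset.prod_nonneg fun i _ => boolWeight_nonneg hp0 hp1 _
  have hW1 : ∑ x : Fin r → Bool, ∏ i, boolWeight p (x i) = 1 :=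
    sum_prod_eq_one _ (sum_boolWeight p)
  have hpq0 : 0 ≤ p * (1 - p) := mul_nonneg hp0 (by linarith)
  have hpq1 : p * (1 - p) ≤ 1 / 4 := by nlinarith [sq_nonneg (2 * p - 1)]
  have hn : (0 : ℝ) ≤ n := Nat.cast_nonneg n
  -- The last two hypotheses on `ρ` and `s` control the prefactor and the exponent separately.
  have key : ∀ ρ s : ℝ, 0 ≤ s → s < 1 → ρ * s ≤ 1 →
      (∀ a : CubeForm r, a ≠ 0 → ρ ≤ ∑ x : Fin r → Bool, (∏ i, boolWeight p (x i)) *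
        if evalForm (fun i => boolSign (x i)) a = 0 then 0 else 1) →
      (1 - s)⁻¹ ^ Fintype.card (IncreasingPair r) ≤ (r : ℝ) ^ 2 →
      4 * (p * (1 - p)) ^ 2 ≤ ρ * s * (r : ℝ) ^ 2 →
      ∑ y : Fin n → Fin r → Bool, (∏ k, ∏ i, boolWeight p (y k i)) *
        commonZeroIndicator (fun x : Fin r → Bool => evalForm fun i => boolSign (x i)) ⊤ y ≤
      (r : ℝ) ^ 2 * Real.exp (-(4 * p ^ 2 * (1 - p) ^ 2 * n) / (r : ℝ) ^ 2) := by
    intro ρ s hs0 hs1 hρs hρ hcard hexp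
    refine (sum_commonZeroIndicator_top_le _ hW0 hW1 _ hs0 hs1 hρs hρ n).trans ?_
    rw [finrank_cubeForm, Nat.add_sub_cancel]
    refine mul_le_mul hcard (Real.exp_le_exp.2 ?_) (Real.exp_pos _).le (by positivity)
    rw [neg_div, neg_le_neg_iff, div_le_iff₀ (by positivity)]
    have := mul_le_mul_of_nonneg_right hexp hn
    linarith
  have hcard := card_increasingPair r
  have hcases : r = 1 ∨ r = 2 ∨ 3 ≤ r := by omega
  rcases hcases with rfl | rfl | hr3
  · have h0 : Fintype.card (IncreasingPair 1) = 0 := by omega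
    have : IsEmpty (IncreasingPair 1) := Fintype.card_eq_zero_iff.1 h0
    refine key 1 (3 / 4) (by norm_num) (by norm_num) (by norm_num) (fun a ha => ?_) ?_ ?_
    · exact (prob_evalForm_ne_zero_of_coeff_eq_zero p a ha (Subsingleton.elim _ _)).ge
    · rw [h0]; norm_num
    · norm_num; nlinarith
  · have h1 : Fintype.card (IncreasingPair 2) = 1 := by omega
    -- Here `4 / r ^ 2 = 1` is not allowed for `s`; `s = 3 / 4` makes the prefactor exactly `4 = r ^
    -- 2`, and `p * (1 - p) ≤ 1 / 4` leaves room in the exponent.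
    refine key (p * (1 - p)) (3 / 4) (by norm_num) (by norm_num) (by linarith)
      (mul_le_prob_evalForm_two_ne_zero hp0 hp1) ?_ ?_
    · rw [h1]; norm_num
    · norm_num; nlinarith
  · have hr3' : (3 : ℝ) ≤ r := by exact_mod_cast hr3
    have hs1 : 4 / (r : ℝ) ^ 2 < 1 := by rw [div_lt_one (by positivity)]; nlinarith
    have hs0 : 0 ≤ 4 / (r : ℝ) ^ 2 := by positivity
    -- `s = 4 / r ^ 2` matches the exponent exactly.
    refine key ((p * (1 - p)) ^ 2) (4 / r ^ 2) hs0 hs1 ?_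
      (sq_le_prob_evalForm_ne_zero hp0 hp1) ?_ ?_
    · exact mul_le_one₀ (pow_le_one₀ hpq0 (by linarith)) hs0 hs1.le
    -- For `r ≥ 4` the prefactor is at most `exp (2 (r² - r) / (r² - 4)) ≤ exp 2 ≤ 16`. This
    -- estimate fails at `r = 3`, where `(9 / 5) ^ 3 ≤ 9` is checked directly.
    · rcases hr3.eq_or_lt with rfl | hr4
      · have h3 : Fintype.card (IncreasingPair 3) = 3 := by omega
        rw [h3]; norm_num
      · have hr4' : (4 : ℝ) ≤ r := by exact_mod_cast hr4
        have hpos : (0 : ℝ) < r ^ 2 - 4 := by nlinarith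
        have hcard' : 2 * (Fintype.card (IncreasingPair r) : ℝ) = r ^ 2 - r := by
          have : (2 * Fintype.card (IncreasingPair r) + r : ℝ) = r ^ 2 := by exact_mod_cast hcard
          linarith
        calc (1 - 4 / (r : ℝ) ^ 2)⁻¹ ^ Fintype.card (IncreasingPair r)
            ≤ Real.exp (4 / (r ^ 2 - 4)) ^ Fintype.card (IncreasingPair r) := by
              refine pow_le_pow_left₀ (inv_nonneg.2 (by linarith)) ?_ _
              refine le_trans (le_of_eq ?_) (Real.add_one_le_exp _)
              have : (r : ℝ) ≠ 0 := by positivity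
              have h' := hpos.ne'
              have : 1 - 4 / (r : ℝ) ^ 2 = (r ^ 2 - 4) / r ^ 2 := by field_simp
              rw [this, inv_div]
              field_simp
              ring
          _ = Real.exp (Fintype.card (IncreasingPair r) * (4 / (r ^ 2 - 4))) := by
              rw [← Real.exp_nat_mul]
          _ ≤ Real.exp 2 := by
              refine Real.exp_le_exp.2 ?_
              rw [mul_div_assoc', div_le_iff₀ hpos]
              nlinarith
          _ ≤ 4 ^ 2 := by
              rw [show (2 : ℝ) = 1 + 1 by norm_num, Real.exp_add]
              have := Real.exp_one_lt_d9
              have := Real.exp_pos 1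
              nlinarith
          _ ≤ (r : ℝ) ^ 2 := by gcongr
    · field_simp
      linarith

/-! ### Transfer to the probability space -/

/-- The `r` sign vectors whose `k`-th entries are encoded by `y k`. -/
def signVectors {r n : ℕ} (y : Fin n → Fin r → Bool) : Fin r → Fin n → ℝ :=
  fun i k => boolSign (y k i)

theorem columnsGeneric_signVectors {r n : ℕ} {y : Fin n → Fin r → Bool}
    (h : commonZeroIndicator (fun x : Fin r → Bool => evalForm fun i => boolSign (x i)) ⊤ y ≠ 1) :
    ColumnsGeneric (signVectors y) := by
  intro a ha
  by_contra hne
  exact h (if_pos ⟨a, trivial, hne, ha⟩)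

theorem sbern_real_singleton (p : unitInterval) (b : Bool) :
    (sbern p).real {boolSign b} = boolWeight p b := by
  classical
  rw [sbern, bernoulliMeasure_real_apply _ (measurableSet_singleton _)]
  cases b <;> norm_num [boolSign, boolWeight]

instance (p : unitInterval) : IsProbabilityMeasure (sbern p) := by
  unfold sbern; infer_instance

theorem ae_sbern (p : unitInterval) : ∀ᵐ z ∂sbern p, ∃ b, z = boolSign b := by
  have hm : MeasurableSet {z : ℝ | ∃ b, z = boolSign b}ᶜ := by
    refine (Set.Finite.measurableSet ?_).compl
    refine (Set.finite_range boolSign).subset ?_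
    rintro z ⟨b, rfl⟩
    exact ⟨b, rfl⟩
  classical
  change sbern p {z : ℝ | ∃ b, z = boolSign b}ᶜ = 0
  rw [sbern, bernoulliMeasure_apply _ hm, if_neg, if_neg]
  · exact fun h => h ⟨false, by simp [boolSign]⟩
  · exact fun h => h ⟨true, by simp [boolSign]⟩

theorem sbernVec_real_singleton (p : unitInterval) {n : ℕ} (b : Fin n → Bool) :
    (sbernVec p n).real {fun k => boolSign (b k)} = ∏ k, boolWeight p (b k) := by
  rw [sbernVec, measureReal_def, Measure.pi_singleton, ENNReal.toReal_prod]
  exact Finset.prod_congr rfl fun k _ => sbern_real_singleton p (b k)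

theorem ae_sbernVec (p : unitInterval) (n : ℕ) :
    ∀ᵐ v ∂sbernVec p n, ∀ k, ∃ b, v k = boolSign b :=
  Filter.eventually_all.2 fun k =>
    (Measure.tendsto_eval_ae_ae (μ := fun _ : Fin n => sbern p) (i := k)).eventually (ae_sbern p)

theorem setOf_eq_signVectors {Ω : Type*} {r n : ℕ} (ξ : Fin r → Ω → Fin n → ℝ)
    (y : Fin n → Fin r → Bool) :
    {ω | (fun i => ξ i ω) = signVectors y} =
      ⋂ i ∈ Finset.univ, ξ i ⁻¹' {fun k => boolSign (y k i)} := by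
  ext ω
  simp [funext_iff, signVectors]

section RandomVectors

variable {Ω : Type*} [MeasurableSpace Ω] {P : Measure Ω} {p : unitInterval} {r n : ℕ}
  {ξ : Fin r → Ω → Fin n → ℝ}

theorem ae_exists_eq_signVectors (hξ : ∀ i, HasLaw (ξ i) (sbernVec p n) P) :
    ∀ᵐ ω ∂P, ∃ y, (fun i => ξ i ω) = signVectors y := by
  have h : ∀ i, ∀ᵐ ω ∂P, ∀ k, ∃ b, ξ i ω k = boolSign b := fun i =>
    ae_of_ae_map (hξ i).aemeasurable (by rw [(hξ i).map_eq]; exact ae_sbernVec p n)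
  filter_upwards [Filter.eventually_all.2 h] with ω hω
  choose b hb using hω
  exact ⟨fun k i => b i k, funext fun i => funext fun k => hb i k⟩

theorem nullMeasurableSet_eq_signVectors (hξ : ∀ i, HasLaw (ξ i) (sbernVec p n) P)
    (y : Fin n → Fin r → Bool) :
    NullMeasurableSet {ω | (fun i => ξ i ω) = signVectors y} P := by
  rw [setOf_eq_signVectors]
  exact Finset.nullMeasurableSet_biInter _ fun i _ =>
    (hξ i).aemeasurable.nullMeasurableSet_preimage (measurableSet_singleton _)

theorem real_eq_signVectors (hξ : ∀ i, HasLaw (ξ i) (sbernVec p n) P) (hind : iIndepFun ξ P)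
    (y : Fin n → Fin r → Bool) :
    P.real {ω | (fun i => ξ i ω) = signVectors y} = ∏ k, ∏ i, boolWeight p (y k i) := by
  rw [setOf_eq_signVectors, measureReal_def,
    hind.measure_inter_preimage_eq_mul _ (fun i _ => measurableSet_singleton _),
    ENNReal.toReal_prod, Finset.prod_comm]
  refine Finset.prod_congr rfl fun i _ => ?_
  rw [← sbernVec_real_singleton p fun k => y k i, measureReal_def, ← (hξ i).map_eq,
    Measure.map_apply_of_aemeasurable (hξ i).aemeasurable (measurableSet_singleton _)]

/-- An event depending only on the vectors is almost surely a finite union of atoms. -/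
theorem nullMeasurableSet_of_signVectors (hξ : ∀ i, HasLaw (ξ i) (sbernVec p n) P)
    (S : (Fin r → Fin n → ℝ) → Prop) : NullMeasurableSet {ω | S fun i => ξ i ω} P := by
  have h : NullMeasurableSet (⋃ y ∈ {y : Fin n → Fin r → Bool | S (signVectors y)},
      {ω | (fun i => ξ i ω) = signVectors y}) P :=
    NullMeasurableSet.biUnion (Set.to_countable _) fun y _ =>
      nullMeasurableSet_eq_signVectors hξ y
  refine h.congr ?_
  filter_upwards [ae_exists_eq_signVectors hξ] with ω ⟨y, hy⟩
  refine propext ⟨fun hω => ?_, fun hω => ?_⟩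
  · obtain ⟨z, hz, hzω⟩ := Set.mem_iUnion₂.1 hω
    change S fun i => ξ i ω
    rw [show (fun i => ξ i ω) = signVectors z from hzω]
    exact hz
  · have hω' : S fun i => ξ i ω := hω
    rw [hy] at hω'
    exact Set.mem_iUnion₂.2 ⟨y, hω', hy⟩

end RandomVectors

theorem theorem2 {Ω : Type*} [MeasurableSpace Ω] (P : Measure Ω) [IsProbabilityMeasure P]
    (p : unitInterval) (hp0 : 0 < p) (hp1 : p < 1) (r n : ℕ) (hr : 1 ≤ r)
    (F : Ω → Set (Matrix (Fin n) (Fin n) ℝ)) (hF : IsRandomFace P p r n F) :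
    NullMeasurableSet {ω | IsSimplicialFace (elliptope n) (F ω) (r - 1)} P ∧
      1 - (r : ℝ) ^ 2 * Real.exp (-(4 * (p : ℝ) ^ 2 * (1 - (p : ℝ)) ^ 2 * (n : ℝ)) / (r : ℝ) ^ 2)
        ≤ P.real {ω | IsSimplicialFace (elliptope n) (F ω) (r - 1)} := by
  classical
  obtain ⟨ξ, hξ, hind, hFξ⟩ := hF
  simp only [hFξ]
  have hmeas := nullMeasurableSet_of_signVectors hξ
    fun c => IsSimplicialFace (elliptope n) (cutHull c) (r - 1)
  refine ⟨hmeas, ?_⟩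
  set E := {ω | IsSimplicialFace (elliptope n) (cutHull fun i => ξ i ω) (r - 1)} with hE
  set bad : (Fin n → Fin r → Bool) → ℝ :=
    commonZeroIndicator (fun x : Fin r → Bool => evalForm fun i => boolSign (x i)) ⊤ with hbad
  -- Only one inclusion is needed: almost surely, failure of the face property forces non-generic
  -- columns.
  have hsub : (Eᶜ : Set Ω) ≤ᵐ[P] ⋃ y ∈ Finset.univ.filter fun y => bad y = 1,
      {ω | (fun i => ξ i ω) = signVectors y} := by
    filter_upwards [ae_exists_eq_signVectors hξ] with ω ⟨y, hy⟩ hω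
    refine Set.mem_iUnion₂.2 ⟨y, ?_, hy⟩
    by_contra hy1
    refine hω ?_
    change IsSimplicialFace (elliptope n) (cutHull fun i => ξ i ω) (r - 1)
    rw [hy]
    exact (columnsGeneric_signVectors (by simpa using hy1)).isSimplicialFace hr
      fun i k => boolSign_mul_self _
  have hbound : P.real Eᶜ ≤ (r : ℝ) ^ 2 *
      Real.exp (-(4 * (p : ℝ) ^ 2 * (1 - (p : ℝ)) ^ 2 * (n : ℝ)) / (r : ℝ) ^ 2) := by
    calc P.real Eᶜ ≤ P.real (⋃ y ∈ Finset.univ.filter fun y => bad y = 1,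
          {ω | (fun i => ξ i ω) = signVectors y}) :=
          ENNReal.toReal_mono (measure_ne_top _ _) (measure_mono_ae hsub)
      _ ≤ ∑ y ∈ Finset.univ.filter fun y => bad y = 1,
          P.real {ω | (fun i => ξ i ω) = signVectors y} := measureReal_biUnion_finset_le _ _
      _ = ∑ y, (∏ k, ∏ i, boolWeight p (y k i)) * bad y := by
          rw [Finset.sum_filter]
          refine Finset.sum_congr rfl fun y _ => ?_
          rw [real_eq_signVectors hξ hind]
          simp only [hbad, commonZeroIndicator]
          split_ifs <;> simp_all
      _ ≤ _ := sum_commonZeroIndicator_evalForm_le p.2.1 p.2.2 hr n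
  rw [probReal_compl_eq_one_sub₀ hmeas] at hbound
  linarith
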